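/- Let $p$ be an odd prime and let $\omega\in\mathbb C$ be a primitive $p$-th root of unity. On $\mathbb C^p$ with basis $|j\rangle$, $j\in\mathbb Z/p$, let $X|j\rangle=|j+1\rangle$ (shift) and $Z|j\rangle=\omega^{j}|j\rangle$ (clock), and let $G\subset U(p)$ be the group generated by $X$ and $Z$. On $\mathbb C^p\otimes\mathbb C^p$ let $U(|i\rangle\otimes|j\rangle)=\omega^{i-j}|i+1\rangle\otimes|j+1\rangle$ and let $$R=R_{X_\epsilon}=\frac1{\sqrt p}\sum_{j=0}^{p-1}\omega^{j^2}U^j$$ be the localized Gaussian $R$-matrix of the $X_\epsilon$ anyon. A braiding circuit of length $L$ on $N$ qudits is a word of length $L$ in the gates $\rho(\sigma_i^{\pm1})$, $1\le i\le N-1$, where $\rho(\sigma_i)=I^{\otimes(i-1)}\otimes R\otimes I^{\otimes(N-i-1)}$. A stabilizer on $N$ qudits is a tensor product of $N$ elements of $G$; it is presented by the list of these $N$ elements. A nonzero vector $\phi$ is stabilized by pairs $(S_i,c_i)$ of a stabilizer and a complex number if $S_i\phi=c_i\phi$ for all $i$; a complete set of stabilizers consists of $N$ such pairs for which a stabilized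 vector exists and is unique up to a scalar factor. Then: 1. $R\,Z_1R^\dagger=\omega^{-l^2}Z_1U^{l}$ with $l=\frac{p+1}{2}$ and $Z_1=Z\otimes I$. 2. All polynomial-length braiding circuits are classically efficiently simulable in the sense of the stabilizer formalism with stabilizer group $G$. That is: $G$ is finite (and independent of $N$); for every $N$, every braiding circuit implements a unitary $V$, and $VSV^\dagger$ is a stabilizer for every stabilizer $S$; and there are a single deterministic multi-stack Turing machine (depending only on $p$ and $\omega$) and a polynomial $P$ such that for every $N$, every braiding circuit of length $L$ on $N$ qudits, implementing $V$, and every stabilizer $S$, the machine, given a presentation of $S$ followed by the gates of the circuit in their order of application (each with its index written in unary, and its sign), outputs a presentation of $VSV^\dagger$ in at most $P(N+L)$ steps. In particular, the time is polynomial in $N$ on circuits whose length is polynomial in $N$. 3. For every braiding circuit, implementing $V$: if a vector $\phi$ is stabilized by finitely many pairs $(S_i,c_i)$, then $V\phi$ is stabilized by the pairs $(VS_iV^\dagger,c_i)$; and if the pairs $(S_i,c_i)$ form a complete set of stabilizers, then so do the pairs $(VS_iV^\dagger,c_i)$. -/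

import Mathlib

open scoped Matrix Kronecker

noncomputable section

/-! ### Qudits, tensor products and local gates

A qudit has a finite index type `d` for its standard basis; the basis of `N` qudits is
`Fin N → d`, and operators on `N` qudits are matrices indexed by it. -/

/-- Operators on `N` qudits with standard basis indexed by `d`. -/
abbrev QuditOp (d : Type) (N : ℕ) : Type := Matrix (Fin N → d) (Fin N → d) ℂ

/-- The tensor product `A 0 ⊗ A 1 ⊗ ⋯ ⊗ A (N - 1)` of `N` one-qudit operators. -/
def tensorOp {d : Type} {N : ℕ} (A : Fin N → Matrix d d ℂ) : QuditOp d N :=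
  Matrix.of fun x y => ∏ i, A i (x i) (y i)

/-- The two-qudit operator `A` acting on the (distinct) tensor factors `i` and `j` of `N` qudits,
tensored with the identity on all other factors. -/
def twoQuditGate {d : Type} [DecidableEq d] {N : ℕ} (i j : Fin N)
    (A : Matrix (d × d) (d × d) ℂ) : QuditOp d N :=
  Matrix.of fun x y =>
    if ∀ k, k ≠ i → k ≠ j → x k = y k then A (x i, x j) (y i, y j) else 0

/-! ### The stabilizer formalism -/

section Stabilizer

variable {d : Type} [Fintype d] [DecidableEq d]

/-- The operator presented by a list of `N` elements of the group `G` of one-qudit unitaries. -/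
def stabilizerOp (G : Subgroup (Matrix.unitaryGroup d ℂ)) {N : ℕ} (S : Fin N → G) :
    QuditOp d N :=
  tensorOp fun i => ((S i : Matrix.unitaryGroup d ℂ) : Matrix d d ℂ)

/-- A stabilizer: a tensor product of `N` elements of the stabilizer group `G`. -/
def IsStabilizer (G : Subgroup (Matrix.unitaryGroup d ℂ)) {N : ℕ} (A : QuditOp d N) : Prop :=
  ∃ S : Fin N → G, stabilizerOp G S = A

/-- The nonzero vector `φ` is stabilized by the pairs `(A i, c i)`. -/
def IsStabilizedBy {N k : ℕ} (A : Fin k → QuditOp d N) (c : Fin k → ℂ)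
    (φ : (Fin N → d) → ℂ) : Prop :=
  φ ≠ 0 ∧ ∀ i, A i *ᵥ φ = c i • φ

/-- A complete set of stabilizers: `N` pairs `(A i, c i)` of a stabilizer and a number, such that
there is a stabilized vector and it is unique up to a scalar factor. -/
def IsCompleteStabilizerSet (G : Subgroup (Matrix.unitaryGroup d ℂ)) {N : ℕ}
    (A : Fin N → QuditOp d N) (c : Fin N → ℂ) : Prop :=
  (∀ i, IsStabilizer G (A i)) ∧
    ∃ φ, IsStabilizedBy A c φ ∧ ∀ ψ, IsStabilizedBy A c ψ → ∃ a : ℂ, ψ = a • φ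

end Stabilizer

/-- A family of quantum circuits on `N` qudits, `N = 0, 1, 2, …`, each with a length, with an
operator that it implements, and with a description over an alphabet. -/
structure CircuitFamily (d : Type) where
  Circuit : ℕ → Type
  length : ∀ {N : ℕ}, Circuit N → ℕ
  op : ∀ {N : ℕ}, Circuit N → QuditOp d N
  Symbol : Type
  code : ∀ {N : ℕ}, Circuit N → List Symbol

/-- The family `F` of circuits is classically efficiently simulable in the sense of the
stabilizer formalism, with the stabilizer group `G`:
`G` is a finite group of one-qudit unitaries, the same for all `N`; the circuits of `F` implement
unitaries, which conjugate stabilizers to stabilizers; and one Turing machine, given the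
presentation of a stabilizer `S` by a list of `N` elements of `G` followed by the description of a
circuit `w` that implements `U`, outputs a presentation of `U S U†` as a list of `N` elements of
`G`, in a number of steps that is bounded by a polynomial in `N` and the length of `w`.
(So the time is polynomial in `N` on circuits whose length is polynomial in `N`.) -/
structure StabilizerSimulable {d : Type} [Fintype d] [DecidableEq d]
    (G : Subgroup (Matrix.unitaryGroup d ℂ)) (F : CircuitFamily d) : Prop where
  finite : Finite G
  unitary : ∀ (N : ℕ) (w : F.Circuit N), F.op w ∈ Matrix.unitaryGroup (Fin N → d) ℂ
  conj_stabilizer : ∀ (N : ℕ) (w : F.Circuit N) (A : QuditOp d N),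
    IsStabilizer G A → IsStabilizer G (F.op w * A * (F.op w)ᴴ)
  polytime : ∃ (M : Turing.TM2ComputableAux (G ⊕ F.Symbol) G) (P : Polynomial ℕ),
    ∀ (N : ℕ) (w : F.Circuit N) (S : Fin N → G), ∃ T : Fin N → G,
      stabilizerOp G T = F.op w * stabilizerOp G S * (F.op w)ᴴ ∧
      Nonempty (Turing.TM2OutputsInTime M.tm
        (((List.ofFn S).map Sum.inl ++ (F.code w).map Sum.inr).map M.inputAlphabet.symm)
        (some ((List.ofFn T).map M.outputAlphabet.symm))
        (P.eval (N + F.length w)))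

/-! ### Clock and shift operators, and the localized Gaussian `R`-matrix -/

section Gaussian

variable (m : ℕ) [NeZero m] (ω : ℂ)

/-- The shift operator `X |j⟩ = |j + 1⟩`. -/
def shiftOp : Matrix (ZMod m) (ZMod m) ℂ :=
  Matrix.of fun a b => if a = b + 1 then 1 else 0

/-- The clock operator `Z |j⟩ = ω ^ j |j⟩`. -/
def clockOp : Matrix (ZMod m) (ZMod m) ℂ :=
  Matrix.diagonal fun j => ω ^ j.val

/-- The generalized Pauli group of one qudit, generated by the shift and the clock operator
(they are unitary when `ω` is an `m`-th root of unity). -/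
def pauliGroup : Subgroup (Matrix.unitaryGroup (ZMod m) ℂ) :=
  Subgroup.closure
    {u | (u : Matrix (ZMod m) (ZMod m) ℂ) = shiftOp m ∨
      (u : Matrix (ZMod m) (ZMod m) ℂ) = clockOp m ω}

/-- `U (|i⟩ ⊗ |j⟩) = ω ^ (i - j) |i + 1⟩ ⊗ |j + 1⟩`. -/
def gaussianU : Matrix (ZMod m × ZMod m) (ZMod m × ZMod m) ℂ :=
  Matrix.of fun a b => if a = (b.1 + 1, b.2 + 1) then ω ^ (b.1 - b.2).val else 0

/-- The localized Gaussian `R`-matrix `m^(-1/2) ∑_{j < m} ω ^ (j ^ 2) U ^ j`. -/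
def gaussianR : Matrix (ZMod m × ZMod m) (ZMod m × ZMod m) ℂ :=
  ((Real.sqrt m : ℝ) : ℂ)⁻¹ • ∑ j ∈ Finset.range m, ω ^ (j ^ 2) • gaussianU m ω ^ j

/-- The operator on `N` qudits of the braid generator with (zero-based) index `i`, that is `R`
on the qudits `i` and `i + 1`, or of its inverse if the sign is `false`. -/
def braidGate {N : ℕ} (g : Fin (N - 1) × Bool) : QuditOp (ZMod m) N :=
  let A : QuditOp (ZMod m) N :=
    twoQuditGate ⟨g.1, by omega⟩ ⟨g.1 + 1, by omega⟩ (gaussianR m ω)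
  if g.2 then A else A⁻¹

/-- The operator of a braiding circuit; the gates are listed in the order of application. -/
def braidOp {N : ℕ} : List (Fin (N - 1) × Bool) → QuditOp (ZMod m) N
  | [] => 1
  | g :: w => braidOp w * braidGate m ω g

/-- The description of a braid word: the generator of index `i` is written as `i` ticks `none`,
followed by its sign. -/
def braidCode {N : ℕ} (w : List (Fin (N - 1) × Bool)) : List (Option Bool) :=
  w.flatMap fun g => List.replicate g.1 none ++ [some g.2]

/-- The braiding circuits: all words in the braid generators and their inverses, on any number
of qudits. -/
def braidingCircuits : CircuitFamily (ZMod m) where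
  Circuit N := List (Fin (N - 1) × Bool)
  length w := List.length w
  op w := braidOp m ω w
  Symbol := Option Bool
  code w := braidCode w

end Gaussian

end

/-!
The operator `U` is the tensor product of two generalized Pauli operators, so every product
`P = A ⊗ B` of Pauli operators commutes with `U` up to a phase: `U ^ k P = χ (2 t k) P U ^ k` for
some `t` modulo `p`, where `χ k = ω ^ k` and `2` is invertible because `p` is odd. Hence
`R P = P R'`, where `R'` is the Gaussian sum with coefficients `χ (j ^ 2 + 2 t j)`, and completing
the square gives `R P R† = χ (- t ^ 2) P U ^ (- t)` (`gaussOp_mul_weylOp`). For `P = Z ⊗ 1` one has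
`t = - (p + 1) / 2`. The right-hand side is again a product of Pauli operators, and the phase is
absorbed by one of the factors since the commutators of `X` and `Z` are scalars. The exponent `t`
is the same for `P` and its image, so conjugation by `R⁻¹` preserves such products as well
(`exists_signedR_mul`). The unitarity of `R` is the vanishing of complete sums of a nontrivial
additive character (`gaussOp_mul_conjTranspose`).

A gate of a braiding circuit therefore replaces two neighbouring entries of the presentation of a
stabilizer by values read off from a finite table (`braidGate_mul_stabilizerOp`). A machine with an
input stack and two stacks for the register does this with `O(N)` steps for each gate
(`simRuns_gate`): it walks to the pair of cells that the unary index of the gate points to, replaces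
them, and rewinds. The statements on stabilized vectors hold for every unitary that conjugates
stabilizers to stabilizers.
-/

/-! ### A stack machine for circuits of nearest-neighbour gates -/

/-- The stacks of the simulating machine: the input, and a register of qudits that is split at the
position of the head into the part to the left of it (nearest cell on top) and the part to the right
of it (nearest cell on top). -/
inductive SimStack
  | input | left | right
  deriving DecidableEq

instance : Fintype SimStack :=
  ⟨{.input, .left, .right}, fun k => by cases k <;> simp⟩

/-- The program labels of the simulating machine. -/
inductive SimLabel
  | load | rewind | scan
  deriving DecidableEq

instance : Fintype SimLabel :=
  ⟨{.load, .rewind, .scan}, fun l => by cases l <;> simp⟩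

/-- The alphabets of the stacks: the input consists of letters of the register and of ticks `none`
and signs `some s`. -/
def SimAlphabet (α : Type) : SimStack → Type
  | .input => α ⊕ Option Bool
  | .left => α
  | .right => α

/-- The stack contents with the given input and the given two halves of the register. -/
def simStacks {α : Type} (I : List (α ⊕ Option Bool)) (L R : List α) :
    ∀ k, List (SimAlphabet α k)
  | .input => I
  | .left => L
  | .right => R

section Machine

variable {α : Type}

/-- The internal memory of the simulating machine: one input symbol and two register cells. -/
abbrev SimState (α : Type) : Type := Option (α ⊕ Option Bool) × Option α × Option α

section

variable (f : Bool → α → α → α × α)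

/-- The effect on a register of the gate with index `g.1` and sign `g.2`. -/
def registerGate {N : ℕ} (S : Fin N → α) (g : Fin (N - 1) × Bool) : Fin N → α :=
  let i : Fin N := ⟨g.1, by omega⟩
  let j : Fin N := ⟨g.1 + 1, by omega⟩
  Function.update (Function.update S i (f g.2 (S i) (S j)).1) j (f g.2 (S i) (S j)).2

/-- On lists, a gate replaces the two cells that follow the first `g.1` cells. -/
theorem ofFn_registerGate {N : ℕ} (S : Fin N → α) (g : Fin (N - 1) × Bool) :
    ∃ (T R : List α) (x y : α), T.length = g.1 ∧ List.ofFn S = T ++ x :: y :: R ∧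
      List.ofFn (registerGate f S g) = T ++ (f g.2 x y).1 :: (f g.2 x y).2 :: R := by
  obtain ⟨⟨i, hi⟩, s⟩ := g
  have hiN : i + 1 < N := by omega
  refine ⟨(List.ofFn S).take i, (List.ofFn S).drop (i + 2), S ⟨i, by omega⟩, S ⟨i + 1, hiN⟩,
    by simp; omega, ?_, ?_⟩
  · apply List.ext_getElem
    · simp; omega
    · intro n h₁ h₂
      rcases lt_trichotomy n i with h | h | h
      · rw [List.getElem_append_left (by simp at h₁ ⊢; omega)]
        simp
      · subst h
        rw [List.getElem_append_right (by simp)]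
        simp [List.getElem_cons, Nat.min_eq_left (show n ≤ N by omega)]
      · rw [List.getElem_append_right (by simp; omega)]
        obtain ⟨k, rfl⟩ : ∃ k, n = i + 1 + k := ⟨n - (i + 1), by omega⟩
        cases k with
        | zero => simp [List.getElem_cons, Nat.min_eq_left (show i ≤ N by omega)]
        | succ k =>
          simp [Nat.min_eq_left (show i ≤ N by omega),
            show i + 1 + (k + 1) - i = k + 2 by omega, show i + 2 + k = i + 1 + (k + 1) by omega]
  · apply List.ext_getElem
    · simp; omega
    · intro n h₁ h₂
      rcases lt_trichotomy n i with h | h | h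
      · rw [List.getElem_append_left (by simp at h₁ ⊢; omega)]
        simp [registerGate, h.ne, show n ≠ i + 1 by omega]
      · subst h
        rw [List.getElem_append_right (by simp)]
        simp [registerGate, List.getElem_cons,
          Nat.min_eq_left (show n ≤ N by omega)]
      · rw [List.getElem_append_right (by simp; omega)]
        obtain ⟨k, rfl⟩ : ∃ k, n = i + 1 + k := ⟨n - (i + 1), by omega⟩
        cases k with
        | zero =>
          simp [registerGate, List.getElem_cons,
            Nat.min_eq_left (show i ≤ N by omega)]
        | succ k =>
          simp [registerGate, Nat.min_eq_left (show i ≤ N by omega), show i + 1 + (k + 1) ≠ i by omega,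
            show i + 1 + (k + 1) - i = k + 2 by omega, show i + 2 + k = i + 1 + (k + 1) by omega]

end

open Turing.TM2.Stmt in
/-- The program of the simulating machine. Label `load` moves the register from the input to the
left stack, `rewind` moves the head to the left end of the register, and `scan` reads the circuit:
a tick moves the head one cell to the right, a sign `s` replaces the two cells `x`, `y` to the
right of the head by the pair `f s x y` and rewinds, and the end of the input halts. The memory
is overwritten by every label, so it is back in its initial state at that point. -/
def simProgram [Inhabited α] (f : Bool → α → α → α × α) :
    SimLabel → Turing.TM2.Stmt (SimAlphabet α) SimLabel (SimState α)
  | .load =>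
    peek .input (fun _ s => (s, none, none)) <|
    branch (fun v => (v.1.bind Sum.getLeft?).isSome)
      (pop .input (fun v _ => v) <|
        push .left (fun v => (v.1.bind Sum.getLeft?).getD default) <|
        goto fun _ => .load)
      (goto fun _ => .rewind)
  | .rewind =>
    pop .left (fun _ s => (none, s, none)) <|
    branch (fun v => v.2.1.isSome)
      (push .right (fun v => v.2.1.getD default) <| goto fun _ => .rewind)
      (goto fun _ => .scan)
  | .scan =>
    pop .input (fun _ s => (s, none, none)) <|
    branch (fun v => v.1.isNone) halt <|
    branch (fun v => ((v.1.bind Sum.getRight?).bind id).isNone)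
      (pop .right (fun v s => (v.1, s, none)) <|
        push .left (fun v => v.2.1.getD default) <| goto fun _ => .scan)
      (pop .right (fun v s => (v.1, s, none)) <|
        pop .right (fun v s => (v.1, v.2.1, s)) <|
        push .right (fun v => (f (((v.1.bind Sum.getRight?).bind id).getD false)
          (v.2.1.getD default) (v.2.2.getD default)).2) <|
        push .right (fun v => (f (((v.1.bind Sum.getRight?).bind id).getD false)
          (v.2.1.getD default) (v.2.2.getD default)).1) <|
        goto fun _ => .rewind)

/-- The configuration with program label `l`, memory `v`, and the given stacks. -/
def simCfg (l : Option SimLabel) (v : SimState α) (I : List (α ⊕ Option Bool)) (L R : List α) :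
    Turing.TM2.Cfg (SimAlphabet α) SimLabel (SimState α) :=
  ⟨l, v, simStacks I L R⟩

variable [Inhabited α] (f : Bool → α → α → α × α)

/-- The simulating machine gets from `a` to `b` in at most `n` steps. -/
def SimRuns (a b : Turing.TM2.Cfg (SimAlphabet α) SimLabel (SimState α)) (n : ℕ) : Prop :=
  Nonempty (StateTransition.EvalsToInTime (Turing.TM2.step (simProgram f)) a (some b) n)

variable {f}

theorem SimRuns.trans {a b c : Turing.TM2.Cfg (SimAlphabet α) SimLabel (SimState α)} {m n : ℕ}
    (h₁ : SimRuns f a b m) (h₂ : SimRuns f b c n) : SimRuns f a c (m + n) := by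
  obtain ⟨h₁⟩ := h₁
  obtain ⟨h₂⟩ := h₂
  rw [add_comm]
  exact ⟨StateTransition.EvalsToInTime.trans _ _ _ _ _ _ h₁ h₂⟩

theorem SimRuns.mono {a b : Turing.TM2.Cfg (SimAlphabet α) SimLabel (SimState α)} {m n : ℕ}
    (h : SimRuns f a b m) (hmn : m ≤ n) : SimRuns f a b n := by
  obtain ⟨h⟩ := h
  exact ⟨⟨h.toEvalsTo, h.steps_le_m.trans hmn⟩⟩

/-- A single step, with the resulting configuration compared stack by stack: on concrete stacks each
of the hypotheses holds by computation. -/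
theorem SimRuns.of_step {l : SimLabel} {v : SimState α} {I : List (α ⊕ Option Bool)} {L R : List α}
    (l' : Option SimLabel) (v' : SimState α) (I' : List (α ⊕ Option Bool)) (L' R' : List α)
    (c : Turing.TM2.Cfg (SimAlphabet α) SimLabel (SimState α))
    (hc : Turing.TM2.stepAux (simProgram f l) v (simStacks I L R) = c)
    (hl : c.l = l') (hv : c.var = v') (hI : c.stk .input = I') (hL : c.stk .left = L')
    (hR : c.stk .right = R') :
    SimRuns f (simCfg (some l) v I L R) (simCfg l' v' I' L' R') 1 := by
  refine ⟨⟨⟨1, ?_⟩, le_rfl⟩⟩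
  change some (Turing.TM2.stepAux (simProgram f l) v (simStacks I L R)) = some _
  rw [hc]
  obtain ⟨l₁, v₁, S⟩ := c
  subst hl hv hI hL hR
  congr 2
  funext k
  cases k <;> rfl

variable (f)

theorem simRuns_load (S : List α) (c : List (Option Bool)) :
    ∀ (v : SimState α) (L : List α), ∃ v',
      SimRuns f (simCfg (some .load) v (S.map Sum.inl ++ c.map Sum.inr) L [])
        (simCfg (some .rewind) v' (c.map Sum.inr) (S.reverse ++ L) []) (S.length + 1) := by
  induction S with
  | nil =>
    intro v L
    cases c with
    | nil => exact ⟨(none, none, none), SimRuns.of_step _ _ _ _ _ _ rfl rfl rfl rfl rfl rfl⟩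
    | cons a c =>
      exact ⟨(some (Sum.inr a), none, none),
        SimRuns.of_step _ _ _ _ _ _ rfl rfl rfl rfl rfl rfl⟩
  | cons x S ih =>
    intro v L
    obtain ⟨v', h⟩ := ih (some (Sum.inl x), none, none) (x :: L)
    refine ⟨v', ?_⟩
    have h₁ : SimRuns f (simCfg (some .load) v ((x :: S).map Sum.inl ++ c.map Sum.inr) L [])
        (simCfg (some .load) (some (Sum.inl x), none, none) (S.map Sum.inl ++ c.map Sum.inr)
          (x :: L) []) 1 :=
      SimRuns.of_step _ _ _ _ _ _ rfl rfl rfl rfl rfl rfl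
    have := h₁.trans h
    simp only [List.reverse_cons, List.append_assoc, List.singleton_append, List.length_cons]
    exact this.mono (by omega)

theorem simRuns_rewind (I : List (α ⊕ Option Bool)) (L : List α) :
    ∀ (v : SimState α) (R : List α),
      SimRuns f (simCfg (some .rewind) v I L R)
        (simCfg (some .scan) (none, none, none) I [] (L.reverse ++ R)) (L.length + 1) := by
  induction L with
  | nil =>
    intro v R
    exact SimRuns.of_step _ _ _ _ _ _ rfl rfl rfl rfl rfl rfl
  | cons x L ih =>
    intro v R
    have h₁ : SimRuns f (simCfg (some .rewind) v I (x :: L) R)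
        (simCfg (some .rewind) (none, some x, none) I L (x :: R)) 1 :=
      SimRuns.of_step _ _ _ _ _ _ rfl rfl rfl rfl rfl rfl
    have := h₁.trans (ih (none, some x, none) (x :: R))
    simp only [List.reverse_cons, List.append_assoc, List.singleton_append, List.length_cons]
    exact this.mono (by omega)

theorem simRuns_ticks (I : List (α ⊕ Option Bool)) (T R : List α) :
    ∀ (v : SimState α) (L : List α), ∃ v',
      SimRuns f (simCfg (some .scan) v (List.replicate T.length (Sum.inr none) ++ I) L (T ++ R))
        (simCfg (some .scan) v' I (T.reverse ++ L) R) T.length := by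
  induction T with
  | nil => intro v L; exact ⟨v, ⟨StateTransition.EvalsToInTime.refl _ _⟩⟩
  | cons x T ih =>
    intro v L
    obtain ⟨v', h⟩ := ih (some (Sum.inr none), some x, none) (x :: L)
    refine ⟨v', ?_⟩
    have h₁ : SimRuns f (simCfg (some .scan) v
          (List.replicate (x :: T).length (Sum.inr none) ++ I) L ((x :: T) ++ R))
        (simCfg (some .scan) (some (Sum.inr none), some x, none)
          (List.replicate T.length (Sum.inr none) ++ I) (x :: L) (T ++ R)) 1 :=
      SimRuns.of_step _ _ _ _ _ _ rfl rfl rfl rfl rfl rfl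
    have := h₁.trans h
    simp only [List.reverse_cons, List.append_assoc, List.singleton_append, List.length_cons]
    exact this.mono (by omega)

/-- One gate, on the two cells that follow the first `T.length` cells. -/
theorem simRuns_gate (I : List (α ⊕ Option Bool)) (T R : List α) (x y : α) (s : Bool)
    (v : SimState α) :
    SimRuns f
      (simCfg (some .scan) v
        (List.replicate T.length (Sum.inr none) ++ Sum.inr (some s) :: I) [] (T ++ x :: y :: R))
      (simCfg (some .scan) (none, none, none) I []
        (T ++ (f s x y).1 :: (f s x y).2 :: R)) (2 * T.length + 2) := by
  obtain ⟨v', h⟩ := simRuns_ticks f (Sum.inr (some s) :: I) T (x :: y :: R) v []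
  have h₁ : SimRuns f
      (simCfg (some .scan) v' (Sum.inr (some s) :: I) T.reverse (x :: y :: R))
      (simCfg (some .rewind) (some (Sum.inr (some s)), some x, some y) I T.reverse
        ((f s x y).1 :: (f s x y).2 :: R)) 1 :=
    SimRuns.of_step _ _ _ _ _ _ rfl rfl rfl rfl rfl rfl
  rw [List.append_nil] at h
  have := (h.trans h₁).trans (simRuns_rewind f I T.reverse _ _)
  simp only [List.reverse_reverse, List.length_reverse] at this
  exact this.mono (by omega)

/-- A circuit takes at most `2 N` steps for each gate, as the head has to leave at least two cells
to its right. -/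
theorem simRuns_circuit {N : ℕ} (w : List (Fin (N - 1) × Bool)) :
    ∀ (S : Fin N → α) (v : SimState α), ∃ v',
      SimRuns f (simCfg (some .scan) v ((braidCode w).map Sum.inr) [] (List.ofFn S))
        (simCfg (some .scan) v' [] [] (List.ofFn (w.foldl (registerGate f) S)))
        (2 * N * w.length) := by
  induction w with
  | nil => intro S v; exact ⟨v, ⟨StateTransition.EvalsToInTime.refl _ _⟩⟩
  | cons g w ih =>
    intro S v
    obtain ⟨v', h⟩ := ih (registerGate f S g) (none, none, none)
    refine ⟨v', ?_⟩
    obtain ⟨T, R, x, y, hT, hS, hS'⟩ := ofFn_registerGate f S g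
    have h₁ := simRuns_gate f ((braidCode w).map Sum.inr) T R x y g.2 v
    rw [← hS, ← hS', hT] at h₁
    have hc : (braidCode (g :: w)).map (Sum.inr : Option Bool → α ⊕ Option Bool) =
        List.replicate g.1 (Sum.inr none) ++ Sum.inr (some g.2) :: (braidCode w).map Sum.inr := by
      simp [braidCode]
    rw [hc, List.foldl_cons]
    refine (h₁.trans h).mono ?_
    have := g.1.2
    rw [List.length_cons, mul_add]
    omega

/-- The simulating machine. -/
def simMachine [Fintype α] : Turing.FinTM2 where
  K := SimStack
  k₀ := .input
  k₁ := .right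
  Γ := SimAlphabet α
  Λ := SimLabel
  main := .load
  σ := SimState α
  initialState := (none, none, none)
  Γk₀Fin := inferInstanceAs (Fintype (α ⊕ Option Bool))
  m := simProgram f

/-- The simulating machine with its identification of alphabets. -/
def simComputer [Fintype α] : Turing.TM2ComputableAux (α ⊕ Option Bool) α where
  tm := simMachine f
  inputAlphabet := Equiv.refl _
  outputAlphabet := Equiv.refl _

theorem simComputer_outputsInTime [Fintype α] {N : ℕ} (w : List (Fin (N - 1) × Bool))
    (S : Fin N → α) :
    Nonempty (Turing.TM2OutputsInTime (simComputer f).tm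
      (((List.ofFn S).map Sum.inl ++ (braidCode w).map Sum.inr).map
        (simComputer f).inputAlphabet.symm)
      (some ((List.ofFn (w.foldl (registerGate f) S)).map (simComputer f).outputAlphabet.symm))
      (2 * N * w.length + 2 * N + 3)) := by
  obtain ⟨v₁, h₁⟩ := simRuns_load f (List.ofFn S) (braidCode w) (none, none, none) []
  have h₂ := simRuns_rewind f ((braidCode w).map Sum.inr) ((List.ofFn S).reverse ++ []) v₁ []
  obtain ⟨v₃, h₃⟩ := simRuns_circuit f w S (none, none, none)
  have h₄ : SimRuns f (simCfg (some .scan) v₃ [] [] (List.ofFn (w.foldl (registerGate f) S)))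
      (simCfg none (none, none, none) [] [] (List.ofFn (w.foldl (registerGate f) S))) 1 :=
    SimRuns.of_step _ _ _ _ _ _ rfl rfl rfl rfl rfl rfl
  simp only [List.append_nil, List.reverse_reverse] at h₁ h₂
  have h := (((h₁.trans h₂).trans h₃).trans h₄).mono
    (n := 2 * N * w.length + 2 * N + 3) (by simp; omega)
  have hin : Turing.initList (simComputer f).tm
      (((List.ofFn S).map Sum.inl ++ (braidCode w).map Sum.inr).map
        (simComputer f).inputAlphabet.symm) =
      simCfg (some .load) (none, none, none)
        ((List.ofFn S).map Sum.inl ++ (braidCode w).map Sum.inr) [] [] := by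
    unfold Turing.initList simCfg
    congr 1
    funext k
    cases k
    · exact List.map_id _
    · rfl
    · rfl
  have hout : Turing.haltList (simComputer f).tm
      ((List.ofFn (w.foldl (registerGate f) S)).map (simComputer f).outputAlphabet.symm) =
      simCfg none (none, none, none) [] [] (List.ofFn (w.foldl (registerGate f) S)) := by
    unfold Turing.haltList simCfg
    congr 1
    funext k
    cases k
    · rfl
    · rfl
    · exact List.map_id _
  unfold Turing.TM2OutputsInTime
  rw [Option.map_some, hin, hout]
  exact h

end Machine

/-! ### Local gates and tensor products -/

section Local

variable {d : Type} [DecidableEq d] {N : ℕ}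

theorem prod_eq_pair_mul_prod {i j : Fin N} (hij : i ≠ j) (f : Fin N → ℂ) :
    ∏ k, f k = f i * f j * ∏ k ∈ (Finset.univ.erase i).erase j, f k := by
  rw [mul_assoc, Finset.mul_prod_erase _ f (by simp [hij.symm]),
    Finset.mul_prod_erase _ f (Finset.mem_univ i)]

theorem twoQuditGate_one (i j : Fin N) :
    twoQuditGate i j (1 : Matrix (d × d) (d × d) ℂ) = 1 := by
  ext x y
  simp only [twoQuditGate, Matrix.of_apply, Matrix.one_apply, Prod.mk.injEq]
  by_cases h : x = y
  · subst h; simp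
  · rw [if_neg h]
    by_cases h' : ∀ k, k ≠ i → k ≠ j → x k = y k
    · rw [if_pos h', if_neg]
      rintro ⟨hi, hj⟩
      refine h (funext fun k => ?_)
      by_cases hki : k = i
      · rw [hki, hi]
      · by_cases hkj : k = j
        · rw [hkj, hj]
        · exact h' k hki hkj
    · rw [if_neg h']

theorem twoQuditGate_conjTranspose (i j : Fin N) (A : Matrix (d × d) (d × d) ℂ) :
    (twoQuditGate i j A)ᴴ = twoQuditGate i j Aᴴ := by
  ext x y
  simp only [twoQuditGate, Matrix.conjTranspose_apply, Matrix.of_apply, apply_ite star, star_zero,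
    @eq_comm _ (y _)]

variable [Fintype d]

/-- The configurations that agree with `x` off `i` and `j` are parametrized by their values at
`i` and `j`. -/
theorem sum_agree_off_pair {i j : Fin N} (hij : i ≠ j) (x : Fin N → d) (F : (Fin N → d) → ℂ) :
    ∑ z, (if ∀ k, k ≠ i → k ≠ j → x k = z k then F z else 0) =
      ∑ a : d × d, F (Function.update (Function.update x i a.1) j a.2) := by
  classical
  rw [← Finset.sum_filter]
  refine Finset.sum_nbij' (fun z => (z i, z j))
    (fun a => Function.update (Function.update x i a.1) j a.2) (by simp) ?_ ?_ ?_ ?_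
  · intro a _
    simp only [Finset.mem_filter, Finset.mem_univ, true_and]
    intro k hi hj
    simp [hi, hj]
  · intro z hz
    simp only [Finset.mem_filter, Finset.mem_univ, true_and] at hz
    funext k
    by_cases hj : k = j
    · subst hj; simp
    · by_cases hi : k = i
      · subst hi; simp [hj]
      · simp [hj, hi, hz k hi hj]
  · rintro ⟨a, b⟩ _
    simp [hij]
  · intro z hz
    simp only [Finset.mem_filter, Finset.mem_univ, true_and] at hz
    congr 1
    funext k
    by_cases hj : k = j
    · subst hj; simp
    · by_cases hi : k = i
      · subst hi; simp [hj]
      · simp [hj, hi, hz k hi hj]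

theorem twoQuditGate_mul {i j : Fin N} (hij : i ≠ j) (A B : Matrix (d × d) (d × d) ℂ) :
    twoQuditGate i j A * twoQuditGate i j B = twoQuditGate i j (A * B) := by
  ext x y
  simp only [twoQuditGate, Matrix.mul_apply, Matrix.of_apply, ite_mul, zero_mul]
  rw [sum_agree_off_pair hij]
  have h : ∀ a : d × d, (∀ k, k ≠ i → k ≠ j →
      Function.update (Function.update x i a.1) j a.2 k = y k) ↔
      ∀ k, k ≠ i → k ≠ j → x k = y k := by
    intro a
    refine forall_congr' fun k => forall_congr' fun hi => forall_congr' fun hj => ?_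
    simp [hi, hj]
  simp only [h]
  by_cases hxy : ∀ k, k ≠ i → k ≠ j → x k = y k
  · simp [if_pos hxy, hij]
  · simp [if_neg hxy]

theorem twoQuditGate_mem_unitaryGroup {i j : Fin N} (hij : i ≠ j)
    {A : Matrix (d × d) (d × d) ℂ} (hA : A ∈ Matrix.unitaryGroup (d × d) ℂ) :
    twoQuditGate i j A ∈ Matrix.unitaryGroup (Fin N → d) ℂ := by
  rw [Matrix.mem_unitaryGroup_iff, Matrix.star_eq_conjTranspose] at *
  rw [twoQuditGate_conjTranspose, twoQuditGate_mul hij, hA, twoQuditGate_one]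

/-- If a two-qudit gate intertwines two product operators, then so does the local gate on `N`
qudits, provided that the other tensor factors agree. -/
theorem twoQuditGate_mul_tensorOp {i j : Fin N} (hij : i ≠ j) (A : Matrix (d × d) (d × d) ℂ)
    (S T : Fin N → Matrix d d ℂ) (h : A * (S i ⊗ₖ S j) = (T i ⊗ₖ T j) * A)
    (hST : ∀ k, k ≠ i → k ≠ j → S k = T k) :
    twoQuditGate i j A * tensorOp S = tensorOp T * twoQuditGate i j A := by
  ext x y
  have h' := congrFun (congrFun h (x i, x j)) (y i, y j)
  simp only [twoQuditGate, tensorOp, Matrix.mul_apply, Matrix.of_apply, ite_mul, zero_mul,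
    mul_ite, mul_zero, Matrix.kroneckerMap_apply] at h' ⊢
  have hsymm : ∀ z : Fin N → d, (∀ k, k ≠ i → k ≠ j → z k = y k) ↔
      ∀ k, k ≠ i → k ≠ j → y k = z k := fun z => by simp only [@eq_comm _ (z _)]
  simp only [hsymm]
  rw [sum_agree_off_pair hij, sum_agree_off_pair hij]
  have key : ∀ (z w : Fin N → d) (a : d × d), (∏ k ∈ (Finset.univ.erase i).erase j,
      S k (Function.update (Function.update z i a.1) j a.2 k) (w k)) =
      ∏ k ∈ (Finset.univ.erase i).erase j, T k (z k) (w k) := by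
    intro z w a
    refine Finset.prod_congr rfl fun k hk => ?_
    simp only [Finset.mem_erase, Finset.mem_univ, and_true] at hk
    simp [hk.1, hk.2, hST k hk.2 hk.1]
  have key' : ∀ (z w : Fin N → d) (a : d × d), (∏ k ∈ (Finset.univ.erase i).erase j,
      T k (z k) (Function.update (Function.update w i a.1) j a.2 k)) =
      ∏ k ∈ (Finset.univ.erase i).erase j, T k (z k) (w k) := by
    intro z w a
    refine Finset.prod_congr rfl fun k hk => ?_
    simp only [Finset.mem_erase, Finset.mem_univ, and_true] at hk
    simp [hk.1, hk.2]
  simp only [prod_eq_pair_mul_prod hij, key, key']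
  simp only [Function.update_apply, hij, if_true, if_false, ← mul_assoc, ← Finset.sum_mul]
  simp only [Prod.mk.eta, ← mul_assoc] at h' ⊢
  rw [h', Finset.sum_mul]
  exact Finset.sum_congr rfl fun a _ => by ring

end Local

/-! ### Generalized Pauli operators -/

section Pauli

variable {m : ℕ} (χ : AddChar (ZMod m) ℂ)

/-- The generalized Pauli operator `|y⟩ ↦ χ (c + b y) |y + a⟩`, that is `χ c • X ^ a * Z ^ b` where
`Z |y⟩ = χ y |y⟩`. -/
def weylOp (a b c : ZMod m) : Matrix (ZMod m) (ZMod m) ℂ :=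
  Matrix.of fun x y => if x = y + a then χ (c + b * y) else 0

theorem weylOp_zero : weylOp χ 0 0 0 = 1 := by
  ext x y
  simp [weylOp, Matrix.one_apply]

theorem smul_weylOp (a b c t : ZMod m) : χ t • weylOp χ a b c = weylOp χ a b (t + c) := by
  ext x y
  simp [weylOp, ← AddChar.map_add_eq_mul, add_assoc]

/-- Phases may be moved between the tensor factors. -/
theorem weylOp_kronecker_congr {a b c a' b' c' e e' : ZMod m} (h : c + c' = e + e') :
    weylOp χ a b c ⊗ₖ weylOp χ a' b' c' = weylOp χ a b e ⊗ₖ weylOp χ a' b' e' := by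
  ext x y
  simp only [weylOp, Matrix.kroneckerMap_apply, Matrix.of_apply, ite_mul, mul_ite, zero_mul,
    mul_zero, ← AddChar.map_add_eq_mul]
  have : c + b * y.1 + (c' + b' * y.2) = e + b * y.1 + (e' + b' * y.2) := by
    linear_combination h
  rw [this]

variable [NeZero m]

theorem weylOp_mul (a b c a' b' c' : ZMod m) :
    weylOp χ a b c * weylOp χ a' b' c' = weylOp χ (a + a') (b + b') (c + c' + b * a') := by
  ext x y
  simp only [weylOp, Matrix.mul_apply, Matrix.of_apply, mul_ite, mul_zero, Finset.sum_ite_eq',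
    Finset.mem_univ, if_true, ite_mul, zero_mul]
  simp only [← AddChar.map_add_eq_mul]
  congr 1
  · simp only [add_assoc, add_comm a']
  · congr 1; ring

theorem weylOp_conjTranspose (a b c : ZMod m) :
    (weylOp χ a b c)ᴴ = weylOp χ (-a) (-b) (a * b - c) := by
  ext x y
  simp only [weylOp, Matrix.conjTranspose_apply, Matrix.of_apply, apply_ite star, star_zero]
  have : y = x + a ↔ x = y + -a := by
    constructor <;> rintro rfl <;> ring
  simp only [this]
  split_ifs with h
  · rw [← starRingEnd_apply, ← AddChar.map_neg_eq_conj, h]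
    congr 1; ring
  · rfl

theorem weylOp_mem_unitaryGroup (a b c : ZMod m) :
    weylOp χ a b c ∈ Matrix.unitaryGroup (ZMod m) ℂ := by
  rw [Matrix.mem_unitaryGroup_iff, Matrix.star_eq_conjTranspose, weylOp_conjTranspose, weylOp_mul,
    ← weylOp_zero χ]
  congr 1 <;> ring

/-- The generalized Pauli operators as elements of the unitary group. -/
def weylUnitary (a b c : ZMod m) : Matrix.unitaryGroup (ZMod m) ℂ :=
  ⟨weylOp χ a b c, weylOp_mem_unitaryGroup χ a b c⟩

theorem weylUnitary_mul (a b c a' b' c' : ZMod m) :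
    weylUnitary χ a b c * weylUnitary χ a' b' c' =
      weylUnitary χ (a + a') (b + b') (c + c' + b * a') :=
  Subtype.ext (weylOp_mul χ a b c a' b' c')

theorem weylUnitary_inv (a b c : ZMod m) :
    (weylUnitary χ a b c)⁻¹ = weylUnitary χ (-a) (-b) (a * b - c) :=
  Subtype.ext (weylOp_conjTranspose χ a b c)

theorem weylUnitary_zero : weylUnitary χ 0 0 0 = 1 := Subtype.ext (weylOp_zero χ)

end Pauli

section PauliGroup

variable {m : ℕ} [NeZero m] {ω : ℂ} (hω : ω ^ m = 1)

theorem shiftOp_eq_weylOp : shiftOp m = weylOp (AddChar.zmodChar m hω) 1 0 0 := by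
  ext x y
  simp [shiftOp, weylOp]

theorem clockOp_eq_weylOp : clockOp m ω = weylOp (AddChar.zmodChar m hω) 0 1 0 := by
  ext x y
  by_cases h : x = y
  · subst h; simp [clockOp, weylOp, AddChar.zmodChar_apply]
  · simp [clockOp, weylOp, h]

theorem mem_pauliGroup_iff (g : Matrix.unitaryGroup (ZMod m) ℂ) :
    g ∈ pauliGroup m ω ↔ ∃ a b c, g = weylUnitary (AddChar.zmodChar m hω) a b c := by
  set χ := AddChar.zmodChar m hω with hχ
  constructor
  · intro hg
    induction hg using Subgroup.closure_induction with
    | mem x hx =>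
      rcases hx with hx | hx
      · exact ⟨1, 0, 0, Subtype.ext (hx.trans (shiftOp_eq_weylOp hω))⟩
      · exact ⟨0, 1, 0, Subtype.ext (hx.trans (clockOp_eq_weylOp hω))⟩
    | one => exact ⟨0, 0, 0, (weylUnitary_zero χ).symm⟩
    | mul x y _ _ hx hy =>
      obtain ⟨a, b, c, rfl⟩ := hx
      obtain ⟨a', b', c', rfl⟩ := hy
      exact ⟨_, _, _, weylUnitary_mul χ _ _ _ _ _ _⟩
    | inv x _ hx =>
      obtain ⟨a, b, c, rfl⟩ := hx
      exact ⟨_, _, _, weylUnitary_inv χ _ _ _⟩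
  · rintro ⟨a, b, c, rfl⟩
    have hX : weylUnitary χ 1 0 0 ∈ pauliGroup m ω :=
      Subgroup.subset_closure (Or.inl (shiftOp_eq_weylOp hω).symm)
    have hZ : weylUnitary χ 0 1 0 ∈ pauliGroup m ω :=
      Subgroup.subset_closure (Or.inr (clockOp_eq_weylOp hω).symm)
    have hXn : ∀ n : ℕ, weylUnitary χ n 0 0 ∈ pauliGroup m ω := by
      intro n
      induction n with
      | zero => simp [weylUnitary_zero]
      | succ n ih => simpa [weylUnitary_mul] using mul_mem ih hX
    have hZn : ∀ n : ℕ, weylUnitary χ 0 n 0 ∈ pauliGroup m ω := by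
      intro n
      induction n with
      | zero => simp [weylUnitary_zero]
      | succ n ih => simpa [weylUnitary_mul] using mul_mem ih hZ
    have hX' : ∀ a, weylUnitary χ a 0 0 ∈ pauliGroup m ω := fun a => by
      simpa using hXn a.val
    have hZ' : ∀ b, weylUnitary χ 0 b 0 ∈ pauliGroup m ω := fun b => by
      simpa using hZn b.val
    -- the scalar `χ c` is the commutator of `Z ^ c` and `X`
    have hs : weylUnitary χ 0 0 c ∈ pauliGroup m ω := by
      have := mul_mem (mul_mem (hZ' c) (hX' 1)) (mul_mem (hZ' (-c)) (hX' (-1)))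
      simpa [weylUnitary_mul] using this
    simpa [weylUnitary_mul] using mul_mem (mul_mem hs (hX' a)) (hZ' b)

theorem finite_pauliGroup (hω : ω ^ m = 1) : Finite (pauliGroup m ω) := by
  have : (pauliGroup m ω : Set (Matrix.unitaryGroup (ZMod m) ℂ)) ⊆
      Set.range fun t : ZMod m × ZMod m × ZMod m =>
        weylUnitary (AddChar.zmodChar m hω) t.1 t.2.1 t.2.2 := by
    intro g hg
    obtain ⟨a, b, c, rfl⟩ := (mem_pauliGroup_iff hω g).1 hg
    exact ⟨(a, b, c), rfl⟩
  exact ((Set.finite_range _).subset this).to_subtype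

end PauliGroup

/-! ### The Gaussian braid operator -/

section Gauss

variable {m : ℕ} (χ : AddChar (ZMod m) ℂ)

/-- The `k`-th power of the two-qudit operator `U`, for an exponent `k` modulo `m`. -/
def gaussPow (k : ZMod m) : Matrix (ZMod m × ZMod m) (ZMod m × ZMod m) ℂ :=
  weylOp χ k k 0 ⊗ₖ weylOp χ k (-k) 0

theorem gaussPow_zero : gaussPow χ 0 = 1 := by
  simp [gaussPow, weylOp_zero]

variable [NeZero m]

theorem gaussPow_mul (k l : ZMod m) : gaussPow χ k * gaussPow χ l = gaussPow χ (k + l) := by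
  rw [gaussPow, gaussPow, gaussPow, ← Matrix.mul_kronecker_mul, weylOp_mul, weylOp_mul, neg_add]
  exact weylOp_kronecker_congr χ (by ring)

theorem gaussPow_conjTranspose (k : ZMod m) : (gaussPow χ k)ᴴ = gaussPow χ (-k) := by
  rw [gaussPow, gaussPow, Matrix.conjTranspose_kronecker, weylOp_conjTranspose,
    weylOp_conjTranspose]
  exact weylOp_kronecker_congr χ (by ring)

/-- Pauli operators commute with the powers of `U` up to a phase. -/
theorem gaussPow_mul_weylOp (k a b c a' b' c' : ZMod m) :
    gaussPow χ k * (weylOp χ a b c ⊗ₖ weylOp χ a' b' c') =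
      χ ((a - b - a' - b') * k) • ((weylOp χ a b c ⊗ₖ weylOp χ a' b' c') * gaussPow χ k) := by
  rw [gaussPow, ← Matrix.mul_kronecker_mul, ← Matrix.mul_kronecker_mul, weylOp_mul, weylOp_mul,
    weylOp_mul, weylOp_mul, ← Matrix.smul_kronecker, smul_weylOp, add_comm k, add_comm k,
    add_comm k, add_comm (-k)]
  exact weylOp_kronecker_congr χ (by ring)

/-- The Gaussian sum `m^(-1/2) ∑ χ (j ^ 2) U ^ j` over `j` modulo `m`. -/
noncomputable def gaussOp : Matrix (ZMod m × ZMod m) (ZMod m × ZMod m) ℂ :=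
  ((Real.sqrt m : ℝ) : ℂ)⁻¹ • ∑ j : ZMod m, χ (j ^ 2) • gaussPow χ j

theorem gaussianU_pow {ω : ℂ} (hω : ω ^ m = 1) (k : ℕ) :
    gaussianU m ω ^ k = gaussPow (AddChar.zmodChar m hω) k := by
  have h1 : gaussianU m ω = gaussPow (AddChar.zmodChar m hω) 1 := by
    ext x y
    simp only [gaussianU, gaussPow, weylOp, Matrix.kroneckerMap_apply, Matrix.of_apply, ite_mul,
      mul_ite, zero_mul, mul_zero, ← AddChar.map_add_eq_mul, Prod.ext_iff]
    by_cases h₁ : x.1 = y.1 + 1 <;> by_cases h₂ : x.2 = y.2 + 1 <;> simp [h₁, h₂]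
    rw [← AddChar.zmodChar_apply hω, sub_eq_add_neg]
  induction k with
  | zero => simp [gaussPow_zero]
  | succ k ih => rw [pow_succ, ih, h1, gaussPow_mul, Nat.cast_succ]

theorem gaussianR_eq_gaussOp {ω : ℂ} (hω : ω ^ m = 1) :
    gaussianR m ω = gaussOp (AddChar.zmodChar m hω) := by
  rw [gaussianR, gaussOp]
  congr 1
  refine Finset.sum_nbij' (fun j : ℕ => (j : ZMod m)) ZMod.val (by simp) ?_ ?_ (by simp) ?_
  · intro j _
    simpa using ZMod.val_lt j
  · intro j hj
    simpa using ZMod.val_cast_of_lt (Finset.mem_range.1 hj)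
  · intro j _
    rw [gaussianU_pow hω, ← AddChar.zmodChar_apply' hω (j ^ 2), Nat.cast_pow]

/-- Completing the square: conjugation by the Gaussian sum multiplies a Pauli operator whose phase
with `U` is `χ (2 t)` by the power `- t` of `U` and a phase. -/
theorem gaussOp_mul_weylOp (a b c a' b' c' t : ZMod m) (ht : 2 * t = a - b - a' - b') :
    gaussOp χ * (weylOp χ a b c ⊗ₖ weylOp χ a' b' c') =
      (χ (-t ^ 2) • ((weylOp χ a b c ⊗ₖ weylOp χ a' b' c') * gaussPow χ (-t))) * gaussOp χ := by
  rw [gaussOp, Matrix.smul_mul, Matrix.mul_smul, Matrix.sum_mul, Matrix.mul_sum]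
  congr 1
  -- shift the summation index by `t`: `(j + t) ^ 2 - t ^ 2 = j ^ 2 + 2 t j`
  rw [← Equiv.sum_comp (Equiv.addRight t) (fun j => χ (-t ^ 2) •
    ((weylOp χ a b c ⊗ₖ weylOp χ a' b' c') * gaussPow χ (-t)) * χ (j ^ 2) • gaussPow χ j)]
  refine Finset.sum_congr rfl fun j _ => ?_
  rw [Matrix.smul_mul, gaussPow_mul_weylOp, Equiv.coe_addRight, Matrix.mul_smul, Matrix.smul_mul,
    mul_assoc, gaussPow_mul, smul_smul, smul_smul, ← AddChar.map_add_eq_mul,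
    ← AddChar.map_add_eq_mul, ← ht]
  congr 2
  · ring_nf
  · congr 1; ring

theorem weylOp_kronecker_mul_gaussPow (a b c a' b' c' t s : ZMod m) :
    χ s • ((weylOp χ a b c ⊗ₖ weylOp χ a' b' c') * gaussPow χ t) =
      weylOp χ (a + t) (b + t) (s + c + b * t) ⊗ₖ weylOp χ (a' + t) (b' - t) (c' + b' * t) := by
  rw [gaussPow, ← Matrix.mul_kronecker_mul, weylOp_mul, weylOp_mul, ← Matrix.smul_kronecker,
    smul_weylOp, ← sub_eq_add_neg]
  exact weylOp_kronecker_congr χ (by ring)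

end Gauss

section GaussPrime

variable {p : ℕ} [Fact p.Prime] {χ : AddChar (ZMod p) ℂ}

/-- The Gaussian sum is unitary: in the product of the sum with its adjoint the coefficient of
`U ^ n` is a complete sum of the character `k ↦ χ (2 n k)`, which vanishes unless `n = 0`. -/
theorem gaussOp_mul_conjTranspose (h2 : (2 : ZMod p) ≠ 0) (hχ : χ.IsPrimitive) :
    gaussOp χ * (gaussOp χ)ᴴ = 1 := by
  have hsum : (∑ j : ZMod p, χ (j ^ 2) • gaussPow χ j) *
      (∑ j : ZMod p, χ (j ^ 2) • gaussPow χ j)ᴴ = (p : ℂ) • 1 := by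
    rw [Matrix.conjTranspose_sum, Matrix.mul_sum]
    calc ∑ k : ZMod p, (∑ j : ZMod p, χ (j ^ 2) • gaussPow χ j) * (χ (k ^ 2) • gaussPow χ k)ᴴ
        = ∑ k : ZMod p, ∑ n : ZMod p, (χ (n ^ 2) * χ (k * (2 * n))) • gaussPow χ n := by
          refine Finset.sum_congr rfl fun k _ => ?_
          -- substitute `j = n + k`, so that `j ^ 2 - k ^ 2 = n ^ 2 + 2 k n`
          rw [Matrix.sum_mul, ← Equiv.sum_comp (Equiv.addRight k)]
          refine Finset.sum_congr rfl fun n _ => ?_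
          rw [Matrix.conjTranspose_smul, gaussPow_conjTranspose, Equiv.coe_addRight,
            Matrix.smul_mul, Matrix.mul_smul, gaussPow_mul, smul_smul, ← starRingEnd_apply,
            ← AddChar.map_neg_eq_conj, ← AddChar.map_add_eq_mul, ← AddChar.map_add_eq_mul]
          congr 2 <;> ring
      _ = ∑ n : ZMod p, (χ (n ^ 2) * ∑ k : ZMod p, χ (k * (2 * n))) • gaussPow χ n := by
          rw [Finset.sum_comm]
          refine Finset.sum_congr rfl fun n _ => ?_
          rw [Finset.mul_sum, Finset.sum_smul]
      _ = (p : ℂ) • 1 := by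
          simp only [AddChar.sum_mulShift _ hχ, mul_eq_zero, h2, false_or]
          rw [Finset.sum_eq_single 0]
          · simp [gaussPow_zero, ZMod.card]
          · intro n _ hn; simp [hn]
          · simp
  have hs : ((Real.sqrt p : ℝ) : ℂ) * ((Real.sqrt p : ℝ) : ℂ) = p := by
    rw [← Complex.ofReal_mul, Real.mul_self_sqrt (Nat.cast_nonneg p), Complex.ofReal_natCast]
  have hp0 : (p : ℂ) ≠ 0 := Nat.cast_ne_zero.2 (Fact.out : p.Prime).ne_zero
  rw [gaussOp, Matrix.conjTranspose_smul, Matrix.smul_mul, Matrix.mul_smul, hsum, smul_smul,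
    smul_smul, star_inv₀, ← starRingEnd_apply, Complex.conj_ofReal, ← mul_inv, hs,
    inv_mul_cancel₀ hp0, one_smul]

end GaussPrime

/-! ### Conjugation of stabilizers by unitaries -/

section Conj

variable {d : Type} [Fintype d] [DecidableEq d] {N k : ℕ} {V : QuditOp d N}

theorem IsStabilizedBy.conj (hV : V ∈ Matrix.unitaryGroup (Fin N → d) ℂ)
    {A : Fin k → QuditOp d N} {c : Fin k → ℂ} {φ : (Fin N → d) → ℂ} (h : IsStabilizedBy A c φ) :
    IsStabilizedBy (fun i => V * A i * Vᴴ) c (V *ᵥ φ) := by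
  have hV' : Vᴴ * V = 1 := Matrix.mem_unitaryGroup_iff'.1 hV
  refine ⟨fun h0 => h.1 ?_, fun i => ?_⟩
  · rw [← Matrix.one_mulVec φ, ← hV', ← Matrix.mulVec_mulVec, h0, Matrix.mulVec_zero]
  · rw [Matrix.mulVec_mulVec, mul_assoc, hV', mul_one, ← Matrix.mulVec_mulVec, h.2 i,
      Matrix.mulVec_smul]

theorem IsCompleteStabilizerSet.conj {G : Subgroup (Matrix.unitaryGroup d ℂ)}
    (hV : V ∈ Matrix.unitaryGroup (Fin N → d) ℂ)
    (hG : ∀ A : QuditOp d N, IsStabilizer G A → IsStabilizer G (V * A * Vᴴ))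
    {A : Fin N → QuditOp d N} {c : Fin N → ℂ} (h : IsCompleteStabilizerSet G A c) :
    IsCompleteStabilizerSet G (fun i => V * A i * Vᴴ) c := by
  obtain ⟨hA, φ, hφ, huniq⟩ := h
  refine ⟨fun i => hG _ (hA i), V *ᵥ φ, hφ.conj hV, fun ψ hψ => ?_⟩
  have hV₁ : V * Vᴴ = 1 := Matrix.mem_unitaryGroup_iff.1 hV
  have hV₂ : Vᴴ * V = 1 := Matrix.mem_unitaryGroup_iff'.1 hV
  -- pull `ψ` back along `V` and use uniqueness there
  have hback := hψ.conj (Unitary.star_mem hV)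
  simp only [Matrix.star_eq_conjTranspose, Matrix.conjTranspose_conjTranspose] at hback
  have hA' : (fun i => Vᴴ * (V * A i * Vᴴ) * V) = A := by
    funext i
    calc Vᴴ * (V * A i * Vᴴ) * V = (Vᴴ * V) * A i * (Vᴴ * V) := by simp only [mul_assoc]
      _ = A i := by rw [hV₂, one_mul, mul_one]
  rw [hA'] at hback
  obtain ⟨a, ha⟩ := huniq _ hback
  refine ⟨a, ?_⟩
  rw [← Matrix.mulVec_smul, ← ha, Matrix.mulVec_mulVec, hV₁, Matrix.one_mulVec]

end Conj

/-! ### Braiding circuits -/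

section Braid

variable {p : ℕ} [Fact p.Prime]

theorem two_ne_zero_of_odd_prime (hp : Odd p) : (2 : ZMod p) ≠ 0 := by
  intro h
  have h' := (ZMod.natCast_eq_zero_iff 2 p).1 (by exact_mod_cast h)
  rcases (Nat.dvd_prime Nat.prime_two).1 h' with h1 | h1
  · exact (Fact.out : p.Prime).ne_one h1
  · subst h1; exact absurd hp (by decide)

variable {ω : ℂ}

theorem gaussianR_mem_unitaryGroup (hp : Odd p) (hω : IsPrimitiveRoot ω p) :
    gaussianR p ω ∈ Matrix.unitaryGroup (ZMod p × ZMod p) ℂ := by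
  rw [gaussianR_eq_gaussOp hω.pow_eq_one, Matrix.mem_unitaryGroup_iff]
  exact gaussOp_mul_conjTranspose (two_ne_zero_of_odd_prime hp)
    (AddChar.zmodChar_primitive_of_primitive_root p hω)

/-- The operator of a gate of the given sign: `R` or its adjoint, which is its inverse. -/
noncomputable def signedR (p : ℕ) [NeZero p] (ω : ℂ) (s : Bool) :
    Matrix (ZMod p × ZMod p) (ZMod p × ZMod p) ℂ :=
  if s then gaussianR p ω else (gaussianR p ω)ᴴ

theorem signedR_mem_unitaryGroup (hp : Odd p) (hω : IsPrimitiveRoot ω p) (s : Bool) :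
    signedR p ω s ∈ Matrix.unitaryGroup (ZMod p × ZMod p) ℂ := by
  cases s
  · exact Unitary.star_mem (gaussianR_mem_unitaryGroup hp hω)
  · exact gaussianR_mem_unitaryGroup hp hω

theorem braidGate_eq (hp : Odd p) (hω : IsPrimitiveRoot ω p) {N : ℕ} (g : Fin (N - 1) × Bool) :
    braidGate p ω g =
      twoQuditGate ⟨g.1, by omega⟩ ⟨g.1 + 1, by omega⟩ (signedR p ω g.2) := by
  obtain ⟨i, s⟩ := g
  cases s
  · simp only [braidGate, signedR, Bool.false_eq_true, if_false]
    refine Matrix.inv_eq_right_inv ?_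
    have h := gaussianR_mem_unitaryGroup hp hω
    rw [Matrix.mem_unitaryGroup_iff, Matrix.star_eq_conjTranspose] at h
    rw [twoQuditGate_mul (by simp [Fin.ext_iff]), h, twoQuditGate_one]
  · simp [braidGate, signedR]

theorem braidGate_mem_unitaryGroup (hp : Odd p) (hω : IsPrimitiveRoot ω p) {N : ℕ}
    (g : Fin (N - 1) × Bool) :
    braidGate p ω g ∈ Matrix.unitaryGroup (Fin N → ZMod p) ℂ := by
  rw [braidGate_eq hp hω]
  exact twoQuditGate_mem_unitaryGroup (by simp [Fin.ext_iff]) (signedR_mem_unitaryGroup hp hω _)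

theorem braidOp_mem_unitaryGroup (hp : Odd p) (hω : IsPrimitiveRoot ω p) {N : ℕ}
    (w : List (Fin (N - 1) × Bool)) :
    braidOp p ω w ∈ Matrix.unitaryGroup (Fin N → ZMod p) ℂ := by
  induction w with
  | nil => exact one_mem _
  | cons g w ih => exact mul_mem ih (braidGate_mem_unitaryGroup hp hω g)

/-- Conjugation by `R` or its inverse maps a tensor product of two Pauli operators to another one:
it multiplies the operator by a phase and a power of `U`, which is itself such a product. -/
theorem exists_signedR_mul (hp : Odd p) (hω : IsPrimitiveRoot ω p) (s : Bool)
    (x y : pauliGroup p ω) : ∃ z : pauliGroup p ω × pauliGroup p ω,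
      signedR p ω s * ((x.1 : Matrix (ZMod p) (ZMod p) ℂ) ⊗ₖ (y.1 : Matrix (ZMod p) (ZMod p) ℂ)) =
        ((z.1.1 : Matrix (ZMod p) (ZMod p) ℂ) ⊗ₖ (z.2.1 : Matrix (ZMod p) (ZMod p) ℂ)) *
          signedR p ω s := by
  have h2 := two_ne_zero_of_odd_prime hp
  obtain ⟨x, hx⟩ := x
  obtain ⟨y, hy⟩ := y
  obtain ⟨a, b, c, rfl⟩ := (mem_pauliGroup_iff hω.pow_eq_one x).1 hx
  obtain ⟨a', b', c', rfl⟩ := (mem_pauliGroup_iff hω.pow_eq_one y).1 hy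
  set χ := AddChar.zmodChar p hω.pow_eq_one with hχ
  have hmem : ∀ a b c, weylUnitary χ a b c ∈ pauliGroup p ω := fun a b c =>
    (mem_pauliGroup_iff hω.pow_eq_one _).2 ⟨a, b, c, rfl⟩
  set t : ZMod p := (a - b - a' - b') / 2 with ht
  have ht2 : 2 * t = a - b - a' - b' := mul_div_cancel₀ _ h2
  cases s
  · -- the preimage has the same phase `2 * t` with `U`, so it is found by solving for it
    have h := gaussOp_mul_weylOp χ (a + t) (b + t) (c + t ^ 2 + (b + t) * t)
      (a' + t) (b' - t) (c' + (b' - t) * t) t (by rw [ht2]; ring)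
    rw [weylOp_kronecker_mul_gaussPow, ← gaussianR_eq_gaussOp] at h
    have e₁ : weylOp χ (a + t + -t) (b + t + -t)
        (-t ^ 2 + (c + t ^ 2 + (b + t) * t) + (b + t) * -t) = weylOp χ a b c := by
      congr 1 <;> ring
    have e₂ : weylOp χ (a' + t + -t) (b' - t - -t) (c' + (b' - t) * t + (b' - t) * -t) =
        weylOp χ a' b' c' := by
      congr 1 <;> ring
    rw [e₁, e₂] at h
    have hR := gaussianR_mem_unitaryGroup hp hω
    have hR₁ : gaussianR p ω * (gaussianR p ω)ᴴ = 1 := Matrix.mem_unitaryGroup_iff.1 hR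
    have hR₂ : (gaussianR p ω)ᴴ * gaussianR p ω = 1 := Matrix.mem_unitaryGroup_iff'.1 hR
    refine ⟨(⟨_, hmem (a + t) (b + t) (c + t ^ 2 + (b + t) * t)⟩,
      ⟨_, hmem (a' + t) (b' - t) (c' + (b' - t) * t)⟩), ?_⟩
    change (gaussianR p ω)ᴴ * (weylOp χ a b c ⊗ₖ weylOp χ a' b' c') =
      (weylOp χ (a + t) (b + t) (c + t ^ 2 + (b + t) * t) ⊗ₖ
        weylOp χ (a' + t) (b' - t) (c' + (b' - t) * t)) * (gaussianR p ω)ᴴ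
    rw [← mul_one (weylOp χ a b c ⊗ₖ weylOp χ a' b' c'), ← hR₁,
      ← mul_assoc (weylOp χ a b c ⊗ₖ weylOp χ a' b' c'), ← h, ← mul_assoc, ← mul_assoc, hR₂,
      one_mul]
  · refine ⟨(⟨_, hmem (a + -t) (b + -t) (-t ^ 2 + c + b * -t)⟩,
      ⟨_, hmem (a' + -t) (b' - -t) (c' + b' * -t)⟩), ?_⟩
    have h := gaussOp_mul_weylOp χ a b c a' b' c' t ht2
    rw [weylOp_kronecker_mul_gaussPow, ← gaussianR_eq_gaussOp] at h
    exact h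

/-- The action of a gate of sign `s` on a pair of elements of the Pauli group, by conjugation of
their tensor product. -/
noncomputable def pauliGate (hp : Odd p) (hω : IsPrimitiveRoot ω p) (s : Bool)
    (x y : pauliGroup p ω) : pauliGroup p ω × pauliGroup p ω :=
  (exists_signedR_mul hp hω s x y).choose

theorem braidGate_mul_stabilizerOp (hp : Odd p) (hω : IsPrimitiveRoot ω p) {N : ℕ}
    (g : Fin (N - 1) × Bool) (S : Fin N → pauliGroup p ω) :
    braidGate p ω g * stabilizerOp (pauliGroup p ω) S =
      stabilizerOp (pauliGroup p ω) (registerGate (pauliGate hp hω) S g) * braidGate p ω g := by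
  rw [braidGate_eq hp hω]
  have hij : (⟨g.1, by omega⟩ : Fin N) ≠ ⟨g.1 + 1, by omega⟩ := by simp [Fin.ext_iff]
  refine twoQuditGate_mul_tensorOp hij _ _ _ ?_ fun k hi hj => ?_
  · have h := (exists_signedR_mul hp hω g.2 (S ⟨g.1, by omega⟩) (S ⟨g.1 + 1, by omega⟩)).choose_spec
    simpa [registerGate, pauliGate, hij] using h
  · simp [registerGate, hi, hj]

theorem braidOp_mul_stabilizerOp (hp : Odd p) (hω : IsPrimitiveRoot ω p) {N : ℕ}
    (w : List (Fin (N - 1) × Bool)) : ∀ S : Fin N → pauliGroup p ω,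
    braidOp p ω w * stabilizerOp (pauliGroup p ω) S =
      stabilizerOp (pauliGroup p ω) (w.foldl (registerGate (pauliGate hp hω)) S) *
        braidOp p ω w := by
  induction w with
  | nil => intro S; simp [braidOp]
  | cons g w ih =>
    intro S
    rw [braidOp, mul_assoc, braidGate_mul_stabilizerOp hp hω, ← mul_assoc, ih, mul_assoc,
      List.foldl_cons]

theorem braidOp_conj_stabilizerOp (hp : Odd p) (hω : IsPrimitiveRoot ω p) {N : ℕ}
    (w : List (Fin (N - 1) × Bool)) (S : Fin N → pauliGroup p ω) :
    stabilizerOp (pauliGroup p ω) (w.foldl (registerGate (pauliGate hp hω)) S) =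
      braidOp p ω w * stabilizerOp (pauliGroup p ω) S * (braidOp p ω w)ᴴ := by
  have hV : braidOp p ω w * (braidOp p ω w)ᴴ = 1 :=
    Matrix.mem_unitaryGroup_iff.1 (braidOp_mem_unitaryGroup hp hω w)
  rw [braidOp_mul_stabilizerOp hp hω, mul_assoc, hV, mul_one]

theorem isStabilizer_braidOp_conj (hp : Odd p) (hω : IsPrimitiveRoot ω p) {N : ℕ}
    (w : List (Fin (N - 1) × Bool)) (A : QuditOp (ZMod p) N)
    (hA : IsStabilizer (pauliGroup p ω) A) :
    IsStabilizer (pauliGroup p ω) (braidOp p ω w * A * (braidOp p ω w)ᴴ) := by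
  obtain ⟨S, rfl⟩ := hA
  exact ⟨_, braidOp_conj_stabilizerOp hp hω w S⟩

theorem stabilizerSimulable_braidingCircuits (hp : Odd p) (hω : IsPrimitiveRoot ω p) :
    StabilizerSimulable (pauliGroup p ω) (braidingCircuits p ω) where
  finite := finite_pauliGroup hω.pow_eq_one
  unitary _ w := braidOp_mem_unitaryGroup hp hω w
  conj_stabilizer _ w A hA := isStabilizer_braidOp_conj hp hω w A hA
  polytime := by
    have := finite_pauliGroup (m := p) hω.pow_eq_one
    have := Fintype.ofFinite (pauliGroup p ω)
    have : Inhabited (pauliGroup p ω) := ⟨1⟩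
    refine ⟨simComputer (pauliGate hp hω), 2 * Polynomial.X ^ 2 + 2 * Polynomial.X + 3,
      fun N w S => ⟨_, braidOp_conj_stabilizerOp hp hω w S, ?_⟩⟩
    have ⟨h⟩ := simComputer_outputsInTime (pauliGate hp hω) w S
    refine ⟨⟨h.toEvalsTo, h.steps_le_m.trans ?_⟩⟩
    simp only [Polynomial.eval_add, Polynomial.eval_mul, Polynomial.eval_pow, Polynomial.eval_X,
      Polynomial.eval_ofNat]
    change 2 * N * List.length w + 2 * N + 3 ≤
      2 * (N + List.length w) ^ 2 + 2 * (N + List.length w) + 3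
    nlinarith [Nat.zero_le (N * List.length w)]

theorem gaussianR_conj_clockOp (hp : Odd p) (hω : IsPrimitiveRoot ω p) :
    gaussianR p ω * (clockOp p ω ⊗ₖ (1 : Matrix (ZMod p) (ZMod p) ℂ)) * (gaussianR p ω)ᴴ =
      (ω⁻¹) ^ (((p + 1) / 2) ^ 2) •
        ((clockOp p ω ⊗ₖ (1 : Matrix (ZMod p) (ZMod p) ℂ)) * gaussianU p ω ^ ((p + 1) / 2)) := by
  have hR : gaussianR p ω * (gaussianR p ω)ᴴ = 1 :=
    Matrix.mem_unitaryGroup_iff.1 (gaussianR_mem_unitaryGroup hp hω)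
  set l := (p + 1) / 2 with hl
  -- `l` is the inverse of `2` modulo `p`
  have hl2 : 2 * (l : ZMod p) = 1 := by
    have : 2 * l = p + 1 := by obtain ⟨k, rfl⟩ := hp; omega
    have := congrArg (Nat.cast : ℕ → ZMod p) this
    simpa using this
  have h := gaussOp_mul_weylOp (AddChar.zmodChar p hω.pow_eq_one) 0 1 0 0 0 0 (-(l : ZMod p))
    (by linear_combination -hl2)
  rw [weylOp_zero, ← clockOp_eq_weylOp, ← gaussianR_eq_gaussOp, neg_neg, ← gaussianU_pow] at h
  rw [h, mul_assoc, hR, mul_one]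
  congr 1
  rw [neg_sq, AddChar.map_neg_eq_inv, ← Nat.cast_pow, AddChar.zmodChar_apply', inv_pow]

end Braid

theorem mainTheorem2 (p : ℕ) [Fact p.Prime] (hp : Odd p) (ω : ℂ) (hω : IsPrimitiveRoot ω p) :
    -- conjugation of the clock operator on the first of two qudits
    (gaussianR p ω * (clockOp p ω ⊗ₖ (1 : Matrix (ZMod p) (ZMod p) ℂ)) * (gaussianR p ω)ᴴ =
      (ω⁻¹) ^ (((p + 1) / 2) ^ 2) •
        ((clockOp p ω ⊗ₖ (1 : Matrix (ZMod p) (ZMod p) ℂ)) * gaussianU p ω ^ ((p + 1) / 2))) ∧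
    -- efficient classical simulation of braiding circuits
    StabilizerSimulable (pauliGroup p ω) (braidingCircuits p ω) ∧
    -- evolution of stabilized vectors, and of complete sets of stabilizers
    (∀ (N k : ℕ) (w : List (Fin (N - 1) × Bool)) (A : Fin k → QuditOp (ZMod p) N) (c : Fin k → ℂ)
      (φ : (Fin N → ZMod p) → ℂ), (∀ i, IsStabilizer (pauliGroup p ω) (A i)) →
      IsStabilizedBy A c φ →
      IsStabilizedBy (fun i => braidOp p ω w * A i * (braidOp p ω w)ᴴ) c
        (braidOp p ω w *ᵥ φ)) ∧
    (∀ (N : ℕ) (w : List (Fin (N - 1) × Bool)) (A : Fin N → QuditOp (ZMod p) N) (c : Fin N → ℂ),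
      IsCompleteStabilizerSet (pauliGroup p ω) A c →
      IsCompleteStabilizerSet (pauliGroup p ω)
        (fun i => braidOp p ω w * A i * (braidOp p ω w)ᴴ) c) := by
  exact ⟨gaussianR_conj_clockOp hp hω, stabilizerSimulable_braidingCircuits hp hω,
    fun _ _ w _ _ _ _ h => h.conj (braidOp_mem_unitaryGroup hp hω w),
    fun _ w _ _ h => h.conj (braidOp_mem_unitaryGroup hp hω w)
      (isStabilizer_braidOp_conj hp hω w)⟩
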